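/- Let $m\ge 1$ and consider the scalar delay differential equation $$\dot x(t)+f(t,x(t))+\sum_{k=1}^m g_k(t,x(h_k(t)))=0,\quad t\ge 0,\qquad x(t)=\varphi(t),\ t\le 0, \tag{1}$$ where a solution is a function that is absolutely continuous on each interval $[0,T]$, satisfies the equation for almost every $t\ge0$ and satisfies the initial condition for $t\le 0$. Assume: (i) each $h_k$ is Lebesgue measurable on $[0,\infty)$, $h_k(t)\le t$, and $\lim_{t\to\infty}h_k(t)=\infty$; (ii) $f,g_k:[0,\infty)\times\mathbb R\to\mathbb R$ are continuous, $f(t,0)=g_k(t,0)=0$, and $f(t,u)u>0$, $g_k(t,u)u>0$ for all $t\ge 0$, $u\ne0$ and $k=1,\dots,m$; (iii) there are $-\infty\le x_1^0\le 0\le x_2^0\le\infty$ and $-\infty<x_1\le 0\le x_2<\infty$ such that for every bounded Borel measurable $\varphi:(-\infty,0]\to\mathbb R$ with $x_1^0\le\varphi\le x_2^0$ problem (1) has a unique solution $x$, and this solution satisfies $x_1\le x(t)\le x_2$ for all sufficiently large $t$ (in particular, it is enough that this holds for all $t\ge 0$). Suppose that there are positive numbers $a_0$, $A$, $b_1,\dots,b_m$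 such that for all $t\ge0$, all $u\neq0$ with $x_1\le u\le x_2$, and all $k$, $$a_0\le\frac{f(t,u)}{u}\le A,\qquad 0\le\frac{g_k(t,u)}{u}\le b_k,$$ that $t-h_k(t)\le h_0$ for all $t\ge 0$ and all $k$, and that, with $b_0=\sum_{k=1}^m b_k$, $$\frac{a_0}{b_0}e^{-Ah_0}>\ln\frac{b_0^2+a_0b_0}{b_0^2+a_0^2}.$$ Then for every bounded Borel measurable $\varphi:(-\infty,0]\to\mathbb R$ with $x_1^0\le\varphi\le x_2^0$ the solution $x$ of (1) satisfies $\lim_{t\to\infty}x(t)=0$. -/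

import Mathlib

open Set Filter Topology MeasureTheory

/-- Delay functions on `[0, ∞)`: Lebesgue measurable, `h t ≤ t`, and `h t → ∞` as `t → ∞`.
(A real function is Lebesgue measurable on `[0, ∞)` exactly when it is a.e. equal there to a Borel
function.) -/
structure IsDelayFunction (h : ℝ → ℝ) : Prop where
  aemeasurable : AEMeasurable h (volume.restrict (Ici 0))
  le_self : ∀ t, 0 ≤ t → h t ≤ t
  tendsto : Tendsto h atTop atTop

/-- Admissible initial functions: bounded Borel measurable functions on `(-∞, 0]` with values
between the (possibly infinite) bounds `lo` and `hi`. -/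
structure IsAdmissibleInitial (lo hi : EReal) (φ : Iic (0 : ℝ) → ℝ) : Prop where
  measurable : Measurable φ
  bounded : ∃ C : ℝ, ∀ t, |φ t| ≤ C
  lower : ∀ t, lo ≤ (φ t : EReal)
  upper : ∀ t, (φ t : EReal) ≤ hi

/-- `x` is a (global) solution of
`x'(t) + f (t, x t) + ∑ k, g k (t, x (h k t)) = 0` for `t ≥ 0`, with `x t = φ t` for `t ≤ 0`:
it is absolutely continuous on every `[0, T]`, satisfies the equation for almost every `t ≥ 0`,
and satisfies the initial condition. -/
structure IsDelaySolution {m : ℕ} (f : ℝ → ℝ → ℝ) (g : Fin m → ℝ → ℝ → ℝ) (h : Fin m → ℝ → ℝ)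
    (φ : Iic (0 : ℝ) → ℝ) (x : ℝ → ℝ) : Prop where
  absCont : ∀ T, 0 ≤ T → AbsolutelyContinuousOnInterval x 0 T
  initial : ∀ t : Iic (0 : ℝ), x t = φ t
  equation : ∀ᵐ t ∂(volume.restrict (Ici (0 : ℝ))),
    DifferentiableAt ℝ x t ∧ deriv x t + f t (x t) + ∑ k, g k t (x (h k t)) = 0

/-! Measure time by the clock `α`, a primitive of the rate `a t = f (t, x t) / x t`: the equation
becomes `y' = -y + d`, where the feedback `d` opposes the delayed values of `y` with gain
`B = b₀ / a₀`, and delays last at most `H = A h₀`. Let `|x| ≤ K` and let `x` be positive after a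
zero at clock time `0`. Since `d ≤ B K`, looking back from the zero gives `-y(-τ) ≤ B K (e^τ - 1)`,
so that `d(τ) ≤ B K min(1, B (e^{H - τ} - 1))` for `0 ≤ τ ≤ H`, and `d ≤ 0` after `H`. The solution
of `y' = -y + d` with this maximal forcing stays below `θ K`, where `θ < 1` is exactly the
logarithmic condition. Applied to `x` and to `-x`, this turns an eventual bound `K` into an eventual
bound `θ K`. -/

section AbsolutelyContinuous

variable {u v : ℝ}

theorem absolutelyContinuousOnInterval_comp_of_lipschitzOnWith {X Y : Type*} [PseudoMetricSpace X]
    [PseudoMetricSpace Y] {w : X → Y} {α : ℝ → X} {K : NNReal} {s : Set X}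
    (hw : LipschitzOnWith K w s) (hα : AbsolutelyContinuousOnInterval α u v)
    (hs : MapsTo α (uIcc u v) s) : AbsolutelyContinuousOnInterval (w ∘ α) u v := by
  have hlim := Tendsto.const_mul (K : ℝ) hα
  rw [mul_zero] at hlim
  refine squeeze_zero' (Eventually.of_forall fun E => Finset.sum_nonneg fun i _ => dist_nonneg)
    (eventually_inf_principal.2 (Eventually.of_forall fun E hE => ?_)) hlim
  rw [Finset.mul_sum]
  exact Finset.sum_le_sum fun i hi =>
    hw.dist_le_mul _ (hs (hE.1 i hi).1) _ (hs (hE.1 i hi).2)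

theorem absolutelyContinuousOnInterval_comp_of_contDiff {E F : Type*} [NormedAddCommGroup E]
    [NormedSpace ℝ E] [ProperSpace E] [NormedAddCommGroup F] [NormedSpace ℝ F] {w : E → F}
    {α : ℝ → E} (hw : ContDiff ℝ 1 w) (hα : AbsolutelyContinuousOnInterval α u v) :
    AbsolutelyContinuousOnInterval (w ∘ α) u v := by
  obtain ⟨C, hC⟩ := hα.exists_bound
  obtain ⟨K, hK⟩ := (hw.contDiffOn (s := Metric.closedBall 0 C)).exists_lipschitzOnWith one_ne_zero
    (convex_closedBall 0 C) (isCompact_closedBall 0 C)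
  exact absolutelyContinuousOnInterval_comp_of_lipschitzOnWith hK hα fun s hs =>
    mem_closedBall_zero_iff.2 (hC s hs)

theorem le_left_of_ae_deriv_nonpos {y : ℝ → ℝ} (huv : u ≤ v)
    (hy : AbsolutelyContinuousOnInterval y u v) (hd : ∀ᵐ s, s ∈ Icc u v → deriv y s ≤ 0) :
    y v ≤ y u := by
  have hint : ∫ s in u..v, deriv y s ≤ 0 := by
    rw [intervalIntegral.integral_of_le huv]
    refine integral_nonpos_of_ae ((ae_restrict_iff' measurableSet_Ioc).2 ?_)
    filter_upwards [hd] with s hs hmem using hs (Ioc_subset_Icc_self hmem)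
  rw [hy.integral_deriv_eq_sub] at hint
  exact sub_nonpos.1 hint

theorem le_comp_of_supersolution {a α D x w : ℝ → ℝ} (huv : u ≤ v)
    (hx : AbsolutelyContinuousOnInterval x u v) (hα : AbsolutelyContinuousOnInterval α u v)
    (hderiv : ∀ᵐ s, s ∈ Icc u v → HasDerivAt α (a s) s ∧ HasDerivAt x (D s - a s * x s) s)
    (hw : ContDiff ℝ 1 w) (hD : ∀ s ∈ Icc u v, D s ≤ (w (α s) + deriv w (α s)) * a s)
    (hu : x u ≤ w (α u)) : x v ≤ w (α v) := by
  -- `exp (α s)` is the integrating factor of `x' = D - a x`.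
  have hmono := le_left_of_ae_deriv_nonpos (y := Real.exp ∘ α * (x - w ∘ α)) huv
    ((absolutelyContinuousOnInterval_comp_of_contDiff Real.contDiff_exp hα).mul
      (hx.sub (absolutelyContinuousOnInterval_comp_of_contDiff hw hα))) (by
    filter_upwards [hderiv] with s hs hmem
    obtain ⟨hαs, hxs⟩ := hs hmem
    have hws := (hw.differentiable one_ne_zero (α s)).hasDerivAt.comp s hαs
    rw [(((Real.hasDerivAt_exp (α s)).comp s hαs).mul (hxs.sub hws)).deriv]
    have hnonpos := mul_nonpos_of_nonneg_of_nonpos (Real.exp_pos (α s)).le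
      (sub_nonpos.2 (hD s hmem))
    simp only [Pi.sub_apply, Function.comp_apply]
    linear_combination hnonpos)
  have hle : Real.exp (α v) * (x v - w (α v)) ≤ 0 :=
    hmono.trans (mul_nonpos_of_nonneg_of_nonpos (Real.exp_pos _).le (sub_nonpos.2 hu))
  exact sub_nonpos.1 (nonpos_of_mul_nonpos_right hle (Real.exp_pos _))

end AbsolutelyContinuous

theorem forall_lt_or_exists_last_eq {X Y : Type*} [ConditionallyCompleteLinearOrder X]
    [TopologicalSpace X] [OrderTopology X] [DenselyOrdered X] [LinearOrder Y] [TopologicalSpace Y]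
    [OrderClosedTopology Y] {x : X → Y} {u t : X} {c : Y} (hx : ContinuousOn x (Icc u t))
    (hxt : c < x t) :
    (∀ s ∈ Icc u t, c < x s) ∨ ∃ ξ ∈ Icc u t, x ξ = c ∧ ∀ s, ξ < s → s ≤ t → c < x s := by
  by_cases! hall : ∀ s ∈ Icc u t, c < x s
  · exact Or.inl hall
  right
  obtain ⟨s, hs, hxs⟩ := hall
  have hcompact : IsCompact (Icc u t ∩ x ⁻¹' Iic c) :=
    isCompact_Icc.of_isClosed_subset (hx.preimage_isClosed_of_isClosed isClosed_Icc isClosed_Iic)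
      inter_subset_left
  obtain ⟨ξ, ⟨hξ, hxξ⟩, hmax⟩ := hcompact.exists_isGreatest ⟨s, hs, hxs⟩
  have hafter : ∀ s, ξ < s → s ≤ t → c < x s := fun s hξs hst => by
    by_contra! hxs
    exact (hmax ⟨⟨hξ.1.trans hξs.le, hst⟩, hxs⟩).not_gt hξs
  obtain ⟨r, hr, hxr⟩ : c ∈ x '' Icc ξ t :=
    intermediate_value_Icc hξ.2 (hx.mono (Icc_subset_Icc_left hξ.1)) ⟨hxξ, hxt.le⟩
  obtain rfl : ξ = r := hr.1.eq_or_lt.resolve_right fun hξr => (hafter r hξr hr.2).ne' hxr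
  exact ⟨ξ, hξ, hxr, hafter⟩

theorem tendsto_zero_of_eventually_norm_le_mul {X E : Type*} [SeminormedAddCommGroup E]
    {l : Filter X} {x : X → E} {θ K : ℝ} (hθ₀ : 0 ≤ θ) (hθ : θ < 1) (hK₀ : 0 ≤ K)
    (hK : ∀ᶠ t in l, ‖x t‖ ≤ K)
    (hstep : ∀ C, 0 ≤ C → (∀ᶠ t in l, ‖x t‖ ≤ C) → ∀ᶠ t in l, ‖x t‖ ≤ θ * C) :
    Tendsto x l (𝓝 0) := by
  have hiter : ∀ n : ℕ, ∀ᶠ t in l, ‖x t‖ ≤ θ ^ n * K := fun n => by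
    induction n with
    | zero => simpa using hK
    | succ n ih =>
      rw [pow_succ', mul_assoc]
      exact hstep _ (by positivity) ih
  have hlim : Tendsto (fun n : ℕ => θ ^ n * K) atTop (𝓝 0) := by
    simpa using (tendsto_pow_atTop_nhds_zero_of_lt_one hθ₀ hθ).mul_const K
  refine NormedAddGroup.tendsto_nhds_zero.2 fun ε hε => ?_
  obtain ⟨n, hn⟩ := (hlim.eventually_lt_const hε).exists
  filter_upwards [hiter n] with t ht using ht.trans_lt hn

section ExtremalProfile

variable {B H τ : ℝ}

/-- The clock time after a zero at which the two bounds `1` and `B (e^{H - τ} - 1)` for the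
normalised feedback agree. -/
noncomputable def switchTime (B H : ℝ) : ℝ := H - Real.log (1 + 1 / B)

/-- The extremal normalised solution after `switchTime B H`: it solves
`w' = -w + B² (e^{H - τ} - 1)` and continues the solution `B (1 - e^{-τ})` of `w' = -w + B`. -/
noncomputable def extremalProfile (B H τ : ℝ) : ℝ :=
  B ^ 2 * Real.exp (H - τ) * (1 + τ - switchTime B H) - B ^ 2 - B * Real.exp (-τ)

theorem mul_exp_sub_switchTime (hB : 0 < B) : B * Real.exp (H - switchTime B H) = B + 1 := by
  rw [switchTime, sub_sub_cancel, Real.exp_log (by positivity)]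
  field_simp

theorem switchTime_le (hB : 0 < B) : switchTime B H ≤ H :=
  sub_le_self H (Real.log_nonneg (by simp [hB.le]))

theorem extremalProfile_switchTime (hB : 0 < B) :
    extremalProfile B H (switchTime B H) = B * (1 - Real.exp (-switchTime B H)) := by
  rw [extremalProfile]
  linear_combination B * mul_exp_sub_switchTime (H := H) hB

theorem contDiff_extremalProfile : ContDiff ℝ 1 (extremalProfile B H) := by
  unfold extremalProfile
  fun_prop

theorem hasDerivAt_extremalProfile (B H τ : ℝ) : HasDerivAt (extremalProfile B H)
    (B ^ 2 * (Real.exp (H - τ) - 1) - extremalProfile B H τ) τ := by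
  have hexp := ((hasDerivAt_id' τ).const_sub H).exp.const_mul (B ^ 2)
  have hlin := ((hasDerivAt_id' τ).const_add 1).sub_const (switchTime B H)
  refine (((hexp.mul hlin).sub_const (B ^ 2)).sub
    ((hasDerivAt_neg τ).exp.const_mul B)).congr_deriv ?_
  rw [extremalProfile]
  ring

-- `1 + y ≤ e^y` at `y = τ - switchTime B H - L` is sharp at the maximum of `e^τ` times the profile.
theorem extremalProfile_le (hB : 0 < B)
    (hL : B * Real.log ((B ^ 2 + B) / (B ^ 2 + 1)) ≤ Real.exp (-H)) (hτ : τ ≤ H) :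
    extremalProfile B H τ ≤
      1 - B * (Real.exp (-H) - B * Real.log ((B ^ 2 + B) / (B ^ 2 + 1))) := by
  set L := Real.log ((B ^ 2 + B) / (B ^ 2 + 1)) with hLdef
  have htangent : B ^ 2 * Real.exp (H - τ) * (1 + τ - switchTime B H - L) ≤ B ^ 2 + 1 := by
    calc B ^ 2 * Real.exp (H - τ) * (1 + τ - switchTime B H - L)
        ≤ B ^ 2 * Real.exp (H - τ) * Real.exp (τ - switchTime B H - L) := by
          gcongr
          linarith [Real.add_one_le_exp (τ - switchTime B H - L)]
      _ = B * (B * Real.exp (H - switchTime B H)) / Real.exp L := by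
          rw [mul_assoc, ← Real.exp_add, mul_div_assoc, mul_div_assoc, ← Real.exp_sub]
          ring_nf
      _ = B ^ 2 + 1 := by
          rw [mul_exp_sub_switchTime hB, hLdef, Real.exp_log (by positivity)]
          field_simp
  have hgap : 0 ≤ B * (Real.exp (-H) - B * L) := mul_nonneg hB.le (sub_nonneg.2 hL)
  have hgrow := le_mul_of_one_le_right hgap (Real.one_le_exp (sub_nonneg.2 hτ))
  have hexp : Real.exp (-H) * Real.exp (H - τ) = Real.exp (-τ) := by
    rw [← Real.exp_add]
    ring_nf
  rw [extremalProfile]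
  linear_combination htangent + hgrow + B * hexp

theorem log_div_lt_one_div_add_one (hB : 0 < B) :
    Real.log ((B ^ 2 + B) / (B ^ 2 + 1)) < 1 / (B + 1) := by
  calc Real.log ((B ^ 2 + B) / (B ^ 2 + 1))
      ≤ (B ^ 2 + B) / (B ^ 2 + 1) - 1 := Real.log_le_sub_one_of_pos (by positivity)
    _ = (B - 1) / (B ^ 2 + 1) := by field_simp; ring
    _ < 1 / (B + 1) := by
      rw [div_lt_div_iff₀ (by positivity) (by positivity)]
      linarith

-- At `H = log (1 + 1 / B)`, where the switch time vanishes, the condition holds for every `B`.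
theorem exists_ge_switchTime_nonneg {H₀ : ℝ} (hB : 0 < B)
    (hlog : Real.log ((B ^ 2 + B) / (B ^ 2 + 1)) < Real.exp (-H₀) / B) :
    ∃ H, H₀ ≤ H ∧ 0 ≤ switchTime B H ∧
      Real.log ((B ^ 2 + B) / (B ^ 2 + 1)) < Real.exp (-H) / B := by
  refine ⟨max H₀ (Real.log (1 + 1 / B)), le_max_left _ _, sub_nonneg.2 (le_max_right _ _), ?_⟩
  rcases le_total (Real.log (1 + 1 / B)) H₀ with hle | hge
  · rwa [max_eq_left hle]
  · have hexp : Real.exp (-Real.log (1 + 1 / B)) / B = 1 / (B + 1) := by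
      rw [Real.exp_neg, Real.exp_log (by positivity)]
      field_simp
    rw [max_eq_right hge, hexp]
    exact log_div_lt_one_div_add_one hB

end ExtremalProfile

/-- The equation `x' = -a x + D` on `[T, ∞)` with delayed negative feedback of gain `B`: where the
delayed values of `x` are at least `-c`, the feedback satisfies `D ≤ B c a`, and symmetrically. The
clock `α` is a primitive of the rate `a`; measured by it, the delays last at most `H`. -/
structure IsDelayedFeedback {ι : Type*} (B H T : ℝ) (h : ι → ℝ → ℝ) (a α D x : ℝ → ℝ) :
    Prop where
  absCont : ∀ u v, T ≤ u → u ≤ v → AbsolutelyContinuousOnInterval x u v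
  clock_absCont : ∀ u v, T ≤ u → u ≤ v → AbsolutelyContinuousOnInterval α u v
  clock_monotone : Monotone α
  clock_tendsto : Tendsto α atTop atTop
  hasDerivAt : ∀ᵐ s, T ≤ s → HasDerivAt α (a s) s ∧ HasDerivAt x (D s - a s * x s) s
  delay_le : ∀ k s, T ≤ s → h k s ≤ s
  clock_delay_le : ∀ k s, T ≤ s → α s - α (h k s) ≤ H
  le_feedback : ∀ s, T ≤ s → ∀ c, 0 ≤ c → (∀ k, x (h k s) ≤ c) → -(B * c * a s) ≤ D s
  feedback_le : ∀ s, T ≤ s → ∀ c, 0 ≤ c → (∀ k, -x (h k s) ≤ c) → D s ≤ B * c * a s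

namespace IsDelayedFeedback

variable {ι : Type*} {B H T : ℝ} {h : ι → ℝ → ℝ} {a α D x : ℝ → ℝ}

theorem neg (p : IsDelayedFeedback B H T h a α D x) :
    IsDelayedFeedback B H T h a α (-D) (-x) where
  __ := p
  absCont u v hu huv := (p.absCont u v hu huv).neg
  hasDerivAt := by
    filter_upwards [p.hasDerivAt] with s hs hT
    refine ⟨(hs hT).1, (hs hT).2.neg.congr_deriv ?_⟩
    simp only [Pi.neg_apply]
    ring
  le_feedback s hs c hc hx := neg_le_neg (p.feedback_le s hs c hc hx)
  feedback_le s hs c hc hx :=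
    neg_le.1 (p.le_feedback s hs c hc fun k => by simpa using hx k)

theorem mono {H' T' : ℝ} (p : IsDelayedFeedback B H T h a α D x) (hH : H ≤ H') (hT : T ≤ T') :
    IsDelayedFeedback B H' T' h a α D x where
  __ := p
  absCont u v hu := p.absCont u v (hT.trans hu)
  clock_absCont u v hu := p.clock_absCont u v (hT.trans hu)
  hasDerivAt := by
    filter_upwards [p.hasDerivAt] with s hs hs' using hs (hT.trans hs')
  delay_le k s hs := p.delay_le k s (hT.trans hs)
  clock_delay_le k s hs := (p.clock_delay_le k s (hT.trans hs)).trans hH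
  le_feedback s hs := p.le_feedback s (hT.trans hs)
  feedback_le s hs := p.feedback_le s (hT.trans hs)

theorem eventually_le_delay (p : IsDelayedFeedback B H T h a α D x) (c : ℝ) :
    ∀ᶠ s in atTop, ∀ k, c ≤ h k s := by
  filter_upwards [eventually_ge_atTop T, p.clock_tendsto.eventually_gt_atTop (α c + H)]
    with s hs hαs k
  exact (p.clock_monotone.reflect_lt (by linarith [p.clock_delay_le k s hs])).le

theorem exists_clock_eq {u v c : ℝ} (p : IsDelayedFeedback B H T h a α D x) (hu : T ≤ u)
    (huv : u ≤ v) (hc : c ∈ Icc (α u) (α v)) : ∃ σ ∈ Icc u v, α σ = c := by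
  have hcont := (p.clock_absCont u v hu huv).continuousOn
  rw [uIcc_of_le huv] at hcont
  exact intermediate_value_Icc huv hcont hc

theorem le_comp_clock {w : ℝ → ℝ} {u v : ℝ} (p : IsDelayedFeedback B H T h a α D x) (hu : T ≤ u)
    (huv : u ≤ v) (hw : ContDiff ℝ 1 w)
    (hD : ∀ s ∈ Icc u v, D s ≤ (w (α s) + deriv w (α s)) * a s) (hxu : x u ≤ w (α u)) :
    x v ≤ w (α v) := by
  refine le_comp_of_supersolution huv (p.absCont u v hu huv) (p.clock_absCont u v hu huv) ?_ hw hD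
    hxu
  filter_upwards [p.hasDerivAt] with s hs hmem using hs (hu.trans hmem.1)

theorem le_add_mul_exp {u v C : ℝ} (p : IsDelayedFeedback B H T h a α D x) (hu : T ≤ u)
    (huv : u ≤ v) (hD : ∀ s ∈ Icc u v, D s ≤ C * a s) :
    x v ≤ C + (x u - C) * Real.exp (α u - α v) := by
  have hderiv : ∀ τ, HasDerivAt (fun τ => C + (x u - C) * Real.exp (α u - τ))
      ((x u - C) * (Real.exp (α u - τ) * -1)) τ := fun τ =>
    (((hasDerivAt_id' τ).const_sub (α u)).exp.const_mul (x u - C)).const_add C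
  refine p.le_comp_clock (w := fun τ => C + (x u - C) * Real.exp (α u - τ)) hu huv (by fun_prop)
    (fun s hs => ?_) (by simp)
  rw [(hderiv _).deriv]
  exact (hD s hs).trans_eq (by ring)

theorem le_mul_exp {u v : ℝ} (p : IsDelayedFeedback B H T h a α D x) (hu : T ≤ u) (huv : u ≤ v)
    (hx : ∀ s ∈ Icc u v, ∀ k, 0 ≤ x (h k s)) : x v ≤ x u * Real.exp (α u - α v) := by
  have hle := p.le_add_mul_exp (C := 0) hu huv fun s hs => by
    simpa using p.feedback_le s (hu.trans hs.1) 0 le_rfl fun k => neg_nonpos.2 (hx s hs k)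
  simpa using hle

section LastZero

variable {K ξ : ℝ} (p : IsDelayedFeedback B H T h a α D x) (hK : 0 ≤ K)
  (hxK : ∀ s, T ≤ s → ∀ k, -x (h k s) ≤ K) (hxξ : x ξ = 0)
include p hK hxK hxξ

theorem le_mul_one_sub_exp {t : ℝ} (hξ : T ≤ ξ) (ht : ξ ≤ t) :
    x t ≤ B * K * (1 - Real.exp (α ξ - α t)) := by
  have hle := p.le_add_mul_exp hξ ht fun s hs =>
    p.feedback_le s (hξ.trans hs.1) K hK (hxK s (hξ.trans hs.1))
  rw [hxξ] at hle
  exact hle.trans_eq (by ring)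

theorem neg_le_mul_exp_sub_one {s : ℝ} (hs : T ≤ s) (hsξ : s ≤ ξ) :
    -x s ≤ B * K * (Real.exp (α ξ - α s) - 1) := by
  have hle := p.le_add_mul_exp hs hsξ fun r hr =>
    p.feedback_le r (hs.trans hr.1) K hK (hxK r (hs.trans hr.1))
  have hexp : Real.exp (α s - α ξ) * Real.exp (α ξ - α s) = 1 := by
    rw [← Real.exp_add]
    simp
  rw [hxξ] at hle
  linear_combination mul_le_mul_of_nonneg_right hle (Real.exp_pos (α ξ - α s)).le
    + (x s - B * K) * hexp

theorem neg_delayed_le {r δ : ℝ} (hB : 0 ≤ B) (hr : T ≤ r) (hTr : ∀ k, T ≤ h k r)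
    (hpos : ∀ s, ξ < s → s ≤ r → 0 < x s) (hδ₀ : 0 ≤ δ) (hδ : α ξ + H - α r ≤ δ) (k : ι) :
    -x (h k r) ≤ B * K * (Real.exp δ - 1) := by
  rcases le_or_gt (h k r) ξ with hle | hlt
  · refine (p.neg_le_mul_exp_sub_one hK hxK hxξ (hTr k) hle).trans ?_
    gcongr
    linarith [p.clock_delay_le k r hr]
  · have hnonneg : 0 ≤ B * K * (Real.exp δ - 1) :=
      mul_nonneg (mul_nonneg hB hK) (sub_nonneg.2 (Real.one_le_exp hδ₀))
    linarith [hpos _ hlt (p.delay_le k r hr)]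

theorem le_mul_extremalProfile {σ t : ℝ} (hB : 0 < B) (hξ : T ≤ ξ)
    (hdelay : ∀ r, ξ ≤ r → ∀ k, T ≤ h k r) (hσ : ξ ≤ σ) (hσt : σ ≤ t)
    (hασ : α σ = α ξ + switchTime B H) (hαt : α t ≤ α ξ + H)
    (hpos : ∀ s, ξ < s → s ≤ t → 0 < x s) : x t ≤ K * extremalProfile B H (α t - α ξ) := by
  refine p.le_comp_clock (w := fun τ => K * extremalProfile B H (τ - α ξ)) (hξ.trans hσ) hσt
    (contDiff_const.mul (contDiff_extremalProfile.comp (contDiff_id.sub contDiff_const)))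
    (fun r hr => ?_) ?_
  · have hξr : ξ ≤ r := hσ.trans hr.1
    have hremaining : 0 ≤ H - (α r - α ξ) := by linarith [p.clock_monotone hr.2]
    have hD := p.feedback_le r (hξ.trans hξr) (B * K * (Real.exp (H - (α r - α ξ)) - 1))
      (mul_nonneg (by positivity) (sub_nonneg.2 (Real.one_le_exp hremaining)))
      (p.neg_delayed_le hK hxK hxξ hB.le (hξ.trans hξr) (hdelay r hξr)
        (fun s hs hsr => hpos s hs (hsr.trans hr.2)) hremaining (by linarith))
    rw [(((hasDerivAt_extremalProfile B H _).comp_sub_const (α r) (α ξ)).const_mul K).deriv]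
    exact hD.trans_eq (by ring)
  · have hle := p.le_mul_one_sub_exp hK hxK hxξ hξ hσ
    rw [hασ] at hle ⊢
    rw [add_sub_cancel_left, extremalProfile_switchTime hB]
    rw [sub_add_cancel_left] at hle
    exact hle.trans_eq (by ring)

theorem le_mul_of_clock_le {θ t : ℝ} (hB : 0 < B) (hswitch : 0 ≤ switchTime B H)
    (hθ : ∀ τ ∈ Icc (switchTime B H) H, extremalProfile B H τ ≤ θ) (hξ : T ≤ ξ)
    (hdelay : ∀ r, ξ ≤ r → ∀ k, T ≤ h k r) (ht : ξ ≤ t) (hαt : α t ≤ α ξ + H)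
    (hpos : ∀ s, ξ < s → s ≤ t → 0 < x s) : x t ≤ θ * K := by
  rcases le_total (α t) (α ξ + switchTime B H) with hearly | hlate
  · have hθswitch := hθ _ ⟨le_rfl, switchTime_le hB⟩
    rw [extremalProfile_switchTime hB] at hθswitch
    calc x t ≤ B * K * (1 - Real.exp (α ξ - α t)) := p.le_mul_one_sub_exp hK hxK hxξ hξ ht
      _ ≤ B * K * (1 - Real.exp (-switchTime B H)) := by
        gcongr
        linarith
      _ = B * (1 - Real.exp (-switchTime B H)) * K := by ring
      _ ≤ θ * K := by gcongr
  · obtain ⟨σ, hσ, hασ⟩ := p.exists_clock_eq hξ ht ⟨le_add_of_nonneg_right hswitch, hlate⟩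
    calc x t ≤ K * extremalProfile B H (α t - α ξ) :=
          p.le_mul_extremalProfile hK hxK hxξ hB hξ hdelay hσ.1 hσ.2 hασ hαt hpos
      _ ≤ K * θ := by
        gcongr
        exact hθ _ ⟨by linarith, by linarith⟩
      _ = θ * K := mul_comm K θ

theorem le_mul_of_last_zero {θ t : ℝ} (hB : 0 < B) (hswitch : 0 ≤ switchTime B H)
    (hθ : ∀ τ ∈ Icc (switchTime B H) H, extremalProfile B H τ ≤ θ) (hξ : T ≤ ξ)
    (hdelay : ∀ r, ξ ≤ r → ∀ k, T ≤ h k r) (ht : ξ ≤ t)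
    (hpos : ∀ s, ξ < s → s ≤ t → 0 < x s) : x t ≤ θ * K := by
  rcases le_total (α t) (α ξ + H) with hle | hge
  · exact p.le_mul_of_clock_le hK hxK hxξ hB hswitch hθ hξ hdelay ht hle hpos
  obtain ⟨σ, hσ, hασ⟩ := p.exists_clock_eq hξ ht
    ⟨le_add_of_nonneg_right (hswitch.trans (switchTime_le hB)), hge⟩
  have hσK : x σ ≤ θ * K := p.le_mul_of_clock_le hK hxK hxξ hB hswitch hθ hξ hdelay hσ.1 hασ.le
    fun s hs hsσ => hpos s hs (hsσ.trans hσ.2)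
  have hdecay := p.le_mul_exp (hξ.trans hσ.1) hσ.2 fun r hr k => by
    have hξr := hσ.1.trans hr.1
    simpa using p.neg_delayed_le hK hxK hxξ hB.le (hξ.trans hξr) (hdelay r hξr)
      (fun s hs hsr => hpos s hs (hsr.trans hr.2)) le_rfl
      (by linarith [p.clock_monotone hr.1]) k
  have hxσ : 0 ≤ x σ := by
    rcases hσ.1.eq_or_lt with rfl | hlt
    · exact hxξ.ge
    · exact (hpos σ hlt hσ.2).le
  calc x t ≤ x σ * Real.exp (α σ - α t) := hdecay
    _ ≤ x σ := mul_le_of_le_one_right hxσ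
      (Real.exp_le_one_iff.2 (sub_nonpos.2 (p.clock_monotone hσ.2)))
    _ ≤ θ * K := hσK

end LastZero

theorem eventually_le_mul_of_forall_pos {θ K t₀ : ℝ} (p : IsDelayedFeedback B H T h a α D x)
    (hθ : 0 < θ) (hK : 0 ≤ K) (hxK : ∀ᶠ t in atTop, x t ≤ K) :
    ∀ᶠ t in atTop, (∀ s ∈ Icc t₀ t, 0 < x s) → x t ≤ θ * K := by
  obtain ⟨u, hdelay, hTu, hxu⟩ :=
    ((eventually_forall_ge_atTop.2 (p.eventually_le_delay t₀)).and
      ((eventually_ge_atTop T).and hxK)).exists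
  have hlim : Tendsto (fun t => Real.exp (α u - α t)) atTop (𝓝 0) :=
    Real.tendsto_exp_atBot.comp
      (tendsto_atBot_add_const_left _ _ (tendsto_neg_atTop_atBot.comp p.clock_tendsto))
  filter_upwards [eventually_ge_atTop u, hlim.eventually_le_const hθ] with t hut hexp hpos
  calc x t ≤ x u * Real.exp (α u - α t) := p.le_mul_exp hTu hut fun s hs k =>
        (hpos _ ⟨hdelay s hs.1 k, (p.delay_le k s (hTu.trans hs.1)).trans hs.2⟩).le
    _ ≤ K * θ := by gcongr
    _ = θ * K := mul_comm K θ

theorem eventually_le_mul {θ K : ℝ} (p : IsDelayedFeedback B H T h a α D x) (hB : 0 < B)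
    (hswitch : 0 ≤ switchTime B H) (hθ₀ : 0 < θ)
    (hθ : ∀ τ ∈ Icc (switchTime B H) H, extremalProfile B H τ ≤ θ) (hK : 0 ≤ K)
    (hxK : ∀ᶠ t in atTop, |x t| ≤ K) : ∀ᶠ t in atTop, x t ≤ θ * K := by
  obtain ⟨S, hS⟩ := eventually_atTop.1 hxK
  obtain ⟨T', hdelay, hT'⟩ := ((eventually_forall_ge_atTop.2 (p.eventually_le_delay S)).and
    (eventually_ge_atTop T)).exists
  have q := p.mono le_rfl hT'
  obtain ⟨t₀, hdelay₀, ht₀⟩ := ((eventually_forall_ge_atTop.2 (q.eventually_le_delay T')).and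
    (eventually_ge_atTop T')).exists
  filter_upwards [eventually_ge_atTop t₀, q.eventually_le_mul_of_forall_pos (t₀ := t₀) hθ₀ hK
    (hxK.mono fun t ht => (le_abs_self _).trans ht)] with t ht hnonosc
  rcases le_or_gt (x t) 0 with hx | hx
  · exact hx.trans (by positivity)
  have hcont : ContinuousOn x (Icc t₀ t) := by
    simpa only [uIcc_of_le ht] using (q.absCont t₀ t ht₀ ht).continuousOn
  rcases forall_lt_or_exists_last_eq hcont hx with hpos | ⟨ξ, hξ, hxξ, hpos⟩
  · exact hnonosc hpos
  · exact q.le_mul_of_last_zero hK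
      (fun s hs k => (neg_le_abs _).trans (hS _ (hdelay s hs k))) hxξ hB hswitch hθ
      (ht₀.trans hξ.1) (fun r hr => hdelay₀ r (hξ.1.trans hr)) hξ.2 hpos

theorem tendsto_zero {K : ℝ} (p : IsDelayedFeedback B H T h a α D x) (hB : 0 < B)
    (hlog : Real.log ((B ^ 2 + B) / (B ^ 2 + 1)) < Real.exp (-H) / B)
    (hxK : ∀ᶠ t in atTop, |x t| ≤ K) : Tendsto x atTop (𝓝 0) := by
  obtain ⟨H', hHH', hswitch, hlog'⟩ := exists_ge_switchTime_nonneg hB hlog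
  rw [lt_div_iff₀' hB] at hlog'
  have q := p.mono hHH' le_rfl
  set θ := max (1 / 2) (1 - B * (Real.exp (-H') - B * Real.log ((B ^ 2 + B) / (B ^ 2 + 1))))
  have hθ₀ : 0 < θ := lt_max_of_lt_left one_half_pos
  have hθ₁ : θ < 1 := max_lt one_half_lt_one (sub_lt_self 1 (mul_pos hB (sub_pos.2 hlog')))
  have hθ : ∀ τ ∈ Icc (switchTime B H') H', extremalProfile B H' τ ≤ θ := fun τ hτ =>
    (extremalProfile_le hB hlog'.le hτ.2).trans (le_max_right _ _)
  have hK : 0 ≤ K := hxK.exists.elim fun t ht => (abs_nonneg _).trans ht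
  refine tendsto_zero_of_eventually_norm_le_mul hθ₀.le hθ₁ hK hxK fun C hC hxC => ?_
  filter_upwards [q.eventually_le_mul hB hswitch hθ₀ hθ hC hxC,
    q.neg.eventually_le_mul hB hswitch hθ₀ hθ hC (by simpa using hxC)] with t hupper hlower
  exact abs_le'.2 ⟨hupper, hlower⟩

end IsDelayedFeedback

theorem exists_measurable_mul_eq {X : Type*} [TopologicalSpace X] [MeasurableSpace X]
    [OpensMeasurableSpace X] {s : Set X} {F x : X → ℝ} {a₀ A : ℝ} (hs : MeasurableSet s)
    (hF : ContinuousOn F s) (hx : ContinuousOn x s) (haA : a₀ ≤ A)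
    (hzero : ∀ t ∈ s, x t = 0 → F t = 0) (hquot : ∀ t ∈ s, x t ≠ 0 → F t / x t ∈ Icc a₀ A) :
    ∃ a : X → ℝ, Measurable a ∧ (∀ t, a t ∈ Icc a₀ A) ∧ ∀ t ∈ s, a t * x t = F t := by
  classical
  have hmeas : ∀ {y : X → ℝ}, ContinuousOn y s → Measurable (s.indicator y) := fun {y} hy => by
    rw [← piecewise_eq_indicator]
    exact hy.measurable_piecewise continuousOn_const hs
  refine ⟨fun t => projIcc a₀ A haA (s.indicator F t / s.indicator x t),
    (continuous_subtype_val.comp continuous_projIcc).measurable.comp ((hmeas hF).div (hmeas hx)),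
    fun t => Subtype.coe_prop _, fun t ht => ?_⟩
  simp only [indicator_of_mem ht]
  by_cases hxt : x t = 0
  · rw [hxt, mul_zero, hzero t ht hxt]
  · rw [projIcc_of_mem haA (hquot t ht hxt), div_mul_cancel₀ _ hxt]

theorem exists_primitive_of_measurable_of_mem_Icc {a : ℝ → ℝ} {a₀ A : ℝ} (ha : Measurable a)
    (hmem : ∀ t, a t ∈ Icc a₀ A) :
    ∃ α : ℝ → ℝ, (∀ u v, AbsolutelyContinuousOnInterval α u v) ∧
      (∀ᵐ t, HasDerivAt α (a t) t) ∧
      ∀ u v, u ≤ v → α v - α u ∈ Icc (a₀ * (v - u)) (A * (v - u)) := by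
  have hint : ∀ u v, IntervalIntegrable a volume u v := fun u v =>
    (intervalIntegrable_const (c := max |a₀| |A|)).mono_fun' ha.aestronglyMeasurable
      (ae_of_all _ fun t => abs_le_max_abs_abs (hmem t).1 (hmem t).2)
  have hlocal : LocallyIntegrable a volume :=
    (locallyIntegrable_const (max |a₀| |A|)).mono ha.aestronglyMeasurable
      (ae_of_all _ fun t => (abs_le_max_abs_abs (hmem t).1 (hmem t).2).trans (le_abs_self _))
  refine ⟨fun t => ∫ s in (0 : ℝ)..t, a s, fun u v => ?_, ?_, fun u v huv => ?_⟩
  · have hconst : AbsolutelyContinuousOnInterval (fun _ => ∫ s in (0 : ℝ)..u, a s) u v :=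
      contDiffOn_const.absolutelyContinuousOnInterval
    have hsplit : (fun t => ∫ s in (0 : ℝ)..t, a s) =
        (fun _ => ∫ s in (0 : ℝ)..u, a s) + fun t => ∫ s in u..t, a s := funext fun t =>
      (intervalIntegral.integral_add_adjacent_intervals (hint 0 u) (hint u t)).symm
    rw [hsplit]
    exact hconst.add
      ((hint u v).absolutelyContinuousOnInterval_intervalIntegral left_mem_uIcc)
  · filter_upwards [LocallyIntegrable.ae_hasDerivAt_integral hlocal] with t ht using ht 0
  · rw [intervalIntegral.integral_interval_sub_left (hint 0 v) (hint 0 u)]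
    have hlower := intervalIntegral.integral_mono_on huv (intervalIntegrable_const (c := a₀))
      (hint u v) fun t _ => (hmem t).1
    have hupper := intervalIntegral.integral_mono_on huv (hint u v)
      (intervalIntegrable_const (c := A)) fun t _ => (hmem t).2
    rw [intervalIntegral.integral_const, smul_eq_mul, mul_comm] at hlower hupper
    exact ⟨hlower, hupper⟩

theorem tendsto_atTop_of_mul_sub_le {α : ℝ → ℝ} {a₀ : ℝ} (ha₀ : 0 < a₀)
    (hα : ∀ u v, u ≤ v → a₀ * (v - u) ≤ α v - α u) : Tendsto α atTop atTop := by
  refine tendsto_atTop_mono' atTop ?_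
    (tendsto_atTop_add_const_right atTop (α 0) (tendsto_id.const_mul_atTop ha₀))
  filter_upwards [eventually_ge_atTop 0] with t ht
  exact le_sub_iff_add_le.1 (by simpa using hα 0 t ht)

theorem sum_mul_le_sum_div_mul_mul {ι : Type*} {s : Finset ι} {b : ι → ℝ} {a₀ a c : ℝ}
    (ha₀ : 0 < a₀) (ha : a₀ ≤ a) (hb : ∀ k ∈ s, 0 ≤ b k) (hc : 0 ≤ c) :
    ∑ k ∈ s, b k * c ≤ (∑ k ∈ s, b k) / a₀ * c * a := by
  rw [← Finset.sum_mul, div_mul_eq_mul_div, div_mul_eq_mul_div, le_div_iff₀ ha₀]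
  exact mul_le_mul_of_nonneg_left ha (mul_nonneg (Finset.sum_nonneg hb) hc)

theorem le_mul_of_div_mem_Icc {u y b c : ℝ} (hb : 0 ≤ b) (hzero : u = 0 → y = 0)
    (hquot : u ≠ 0 → y / u ∈ Icc 0 b) (hc : 0 ≤ c) (huc : u ≤ c) : y ≤ b * c := by
  rcases eq_or_ne u 0 with hu | hu
  · rw [hzero hu]
    positivity
  · rw [← div_mul_cancel₀ y hu]
    exact (mul_le_mul_of_nonneg_left huc (hquot hu).1).trans
      (mul_le_mul_of_nonneg_right (hquot hu).2 hc)

theorem neg_le_mul_of_div_mem_Icc {u y b c : ℝ} (hb : 0 ≤ b) (hzero : u = 0 → y = 0)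
    (hquot : u ≠ 0 → y / u ∈ Icc 0 b) (hc : 0 ≤ c) (huc : -u ≤ c) : -y ≤ b * c :=
  le_mul_of_div_mem_Icc hb (fun hu => neg_eq_zero.2 (hzero (neg_eq_zero.1 hu)))
    (fun hu => by simpa only [neg_div_neg_eq] using hquot (neg_ne_zero.1 hu)) hc huc

namespace IsDelaySolution

variable {m : ℕ} {f : ℝ → ℝ → ℝ} {g : Fin m → ℝ → ℝ → ℝ} {h : Fin m → ℝ → ℝ}
  {φ : Iic (0 : ℝ) → ℝ} {x : ℝ → ℝ}

theorem continuousOn (hx : IsDelaySolution f g h φ x) : ContinuousOn x (Ici 0) := fun t ht => by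
  have hcont := (hx.absCont (t + 1) (by linarith [mem_Ici.1 ht])).continuousOn
  rw [uIcc_of_le (by linarith [mem_Ici.1 ht])] at hcont
  refine (hcont t ⟨ht, by linarith⟩).mono_of_mem_nhdsWithin ?_
  rw [← Ici_inter_Iic]
  exact inter_mem self_mem_nhdsWithin (mem_nhdsWithin_of_mem_nhds (Iic_mem_nhds (by linarith)))

theorem isDelayedFeedback {T x₁ x₂ a₀ A h₀ : ℝ} {b : Fin m → ℝ} {a α : ℝ → ℝ}
    (hx : IsDelaySolution f g h φ x) (hT : 0 ≤ T)
    (hrange : ∀ k s, T ≤ s → x (h k s) ∈ Icc x₁ x₂) (hh_le : ∀ k t, 0 ≤ t → h k t ≤ t)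
    (h_delay : ∀ k t, 0 ≤ t → t - h k t ≤ h₀) (hg_zero : ∀ k t, 0 ≤ t → g k t 0 = 0)
    (hg_bound : ∀ k t u, 0 ≤ t → u ∈ Icc x₁ x₂ → u ≠ 0 → g k t u / u ∈ Icc 0 (b k))
    (ha₀ : 0 < a₀) (hA : 0 ≤ A) (hb : ∀ k, 0 ≤ b k) (ha : ∀ t, a₀ ≤ a t)
    (hax : ∀ t, T ≤ t → a t * x t = f t (x t))
    (hα_absCont : ∀ u v, AbsolutelyContinuousOnInterval α u v)
    (hα_deriv : ∀ᵐ t, HasDerivAt α (a t) t)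
    (hα_sub : ∀ u v, u ≤ v → α v - α u ∈ Icc (a₀ * (v - u)) (A * (v - u))) :
    IsDelayedFeedback ((∑ k, b k) / a₀) (A * h₀) T h a α
      (fun s => -∑ k, g k s (x (h k s))) x where
  absCont u v hu huv := (hx.absCont v (hT.trans (hu.trans huv))).mono <|
    uIcc_subset_uIcc_right (mem_uIcc_of_le (hT.trans hu) huv)
  clock_absCont u v _ _ := hα_absCont u v
  clock_monotone u v huv := sub_nonneg.1 <|
    (mul_nonneg ha₀.le (sub_nonneg.2 huv)).trans (hα_sub u v huv).1
  clock_tendsto := tendsto_atTop_of_mul_sub_le ha₀ fun u v huv => (hα_sub u v huv).1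
  hasDerivAt := by
    filter_upwards [hα_deriv, (ae_restrict_iff' measurableSet_Ici).1 hx.equation]
      with s hαs hxs hs
    obtain ⟨hdiff, heq⟩ := hxs (hT.trans hs)
    refine ⟨hαs, hdiff.hasDerivAt.congr_deriv ?_⟩
    linear_combination heq + hax s hs
  delay_le k s hs := hh_le k s (hT.trans hs)
  clock_delay_le k s hs := (hα_sub _ _ (hh_le k s (hT.trans hs))).2.trans
    (mul_le_mul_of_nonneg_left (h_delay k s (hT.trans hs)) hA)
  le_feedback s hs c hc hxc := neg_le_neg <|
    (Finset.sum_le_sum fun k _ => le_mul_of_div_mem_Icc (hb k)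
      (fun hxk => by rw [hxk, hg_zero k s (hT.trans hs)])
      (hg_bound k s _ (hT.trans hs) (hrange k s hs)) hc (hxc k)).trans
    (sum_mul_le_sum_div_mul_mul ha₀ (ha s) (fun k _ => hb k) hc)
  feedback_le s hs c hc hxc := by
    rw [← Finset.sum_neg_distrib]
    exact (Finset.sum_le_sum fun k _ => neg_le_mul_of_div_mem_Icc (hb k)
      (fun hxk => by rw [hxk, hg_zero k s (hT.trans hs)])
      (hg_bound k s _ (hT.trans hs) (hrange k s hs)) hc (hxc k)).trans
      (sum_mul_le_sum_div_mul_mul ha₀ (ha s) (fun k _ => hb k) hc)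

theorem exists_isDelayedFeedback {x₁ x₂ a₀ A h₀ : ℝ} {b : Fin m → ℝ}
    (hx : IsDelaySolution f g h φ x) (hrange : ∀ᶠ t in atTop, x t ∈ Icc x₁ x₂)
    (hh_le : ∀ k t, 0 ≤ t → h k t ≤ t) (h_delay : ∀ k t, 0 ≤ t → t - h k t ≤ h₀)
    (hf_cont : ContinuousOn (Function.uncurry f) (Ici (0 : ℝ) ×ˢ univ))
    (hf_zero : ∀ t, 0 ≤ t → f t 0 = 0) (hg_zero : ∀ k t, 0 ≤ t → g k t 0 = 0)
    (ha₀ : 0 < a₀) (haA : a₀ ≤ A) (hb : ∀ k, 0 ≤ b k)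
    (hf_bound : ∀ t u, 0 ≤ t → u ∈ Icc x₁ x₂ → u ≠ 0 → f t u / u ∈ Icc a₀ A)
    (hg_bound : ∀ k t u, 0 ≤ t → u ∈ Icc x₁ x₂ → u ≠ 0 → g k t u / u ∈ Icc 0 (b k)) :
    ∃ T a α, IsDelayedFeedback ((∑ k, b k) / a₀) (A * h₀) T h a α
      (fun s => -∑ k, g k s (x (h k s))) x := by
  obtain ⟨S, hS⟩ := eventually_atTop.1 (hrange.and (eventually_ge_atTop 0))
  have hS₀ : 0 ≤ S := (hS S le_rfl).2
  have hST : S ≤ max S (S + h₀) := le_max_left _ _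
  have hx_cont : ContinuousOn x (Ici S) := hx.continuousOn.mono (Ici_subset_Ici.2 hS₀)
  obtain ⟨a, ha, ha_mem, hax⟩ := exists_measurable_mul_eq (F := fun t => f t (x t))
    measurableSet_Ici
    (hf_cont.comp (continuousOn_id.prodMk hx_cont) fun t ht => ⟨hS₀.trans ht, mem_univ _⟩)
    hx_cont haA (fun t ht hxt => by rw [hxt, hf_zero t (hS₀.trans ht)])
    fun t ht hxt => hf_bound t _ (hS₀.trans ht) (hS t ht).1 hxt
  obtain ⟨α, hα_absCont, hα_deriv, hα_sub⟩ :=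
    exists_primitive_of_measurable_of_mem_Icc ha ha_mem
  refine ⟨max S (S + h₀), a, α, hx.isDelayedFeedback (hS₀.trans hST) (fun k s hs => ?_) hh_le
    h_delay hg_zero hg_bound ha₀ (ha₀.le.trans haA) hb (fun t => (ha_mem t).1)
    (fun t ht => hax t (hST.trans ht)) hα_absCont hα_deriv hα_sub⟩
  have hSs : S + h₀ ≤ s := (le_max_right _ _).trans hs
  exact (hS _ (by linarith [h_delay k s (hS₀.trans (hST.trans hs))])).1

end IsDelaySolution

theorem theorem5_general {m : ℕ} (hm : 1 ≤ m)
    (f : ℝ → ℝ → ℝ) (g : Fin m → ℝ → ℝ → ℝ) (h : Fin m → ℝ → ℝ)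
    (hh_le : ∀ k t, 0 ≤ t → h k t ≤ t)
    (hf_cont : ContinuousOn (Function.uncurry f) (Ici (0 : ℝ) ×ˢ univ))
    (hf_zero : ∀ t, 0 ≤ t → f t 0 = 0)
    (hg_zero : ∀ k t, 0 ≤ t → g k t 0 = 0)
    (x₁ x₂ a₀ A h₀ : ℝ) (b : Fin m → ℝ) (b₀ : ℝ)
    (ha₀ : 0 < a₀) (hb : ∀ k, 0 < b k) (hb₀ : b₀ = ∑ k, b k)
    (hf_bound : ∀ t u, 0 ≤ t → x₁ ≤ u → u ≤ x₂ → u ≠ 0 → a₀ ≤ f t u / u ∧ f t u / u ≤ A)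
    (hg_bound : ∀ k t u, 0 ≤ t → x₁ ≤ u → u ≤ x₂ → u ≠ 0 →
      0 ≤ g k t u / u ∧ g k t u / u ≤ b k)
    (h_delay : ∀ k t, 0 ≤ t → t - h k t ≤ h₀)
    (h_main : a₀ / b₀ * Real.exp (-(A * h₀)) >
      Real.log ((b₀ ^ 2 + a₀ * b₀) / (b₀ ^ 2 + a₀ ^ 2)))
    (φ : Iic (0 : ℝ) → ℝ) (x : ℝ → ℝ) (hx : IsDelaySolution f g h φ x)
    (h_bounds : ∀ᶠ t in atTop, x₁ ≤ x t ∧ x t ≤ x₂) : Tendsto x atTop (𝓝 0) := by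
  by_cases hzero : ∀ᶠ t in atTop, x t = 0
  · exact tendsto_const_nhds.congr' (hzero.mono fun t ht => ht.symm)
  obtain ⟨t, hxt, ht, hmem⟩ :=
    ((not_eventually.1 hzero).and_eventually ((eventually_ge_atTop 0).and h_bounds)).exists
  have haA : a₀ ≤ A := (hf_bound t (x t) ht hmem.1 hmem.2 hxt).elim le_trans
  have hb₀_pos : 0 < b₀ :=
    hb₀ ▸ Finset.sum_pos (fun k _ => hb k) ⟨⟨0, hm⟩, Finset.mem_univ _⟩
  obtain ⟨T, a, α, p⟩ := hx.exists_isDelayedFeedback h_bounds hh_le h_delay hf_cont hf_zero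
    hg_zero ha₀ haA (fun k => (hb k).le)
    (fun t u ht hu => hf_bound t u ht hu.1 hu.2) fun k t u ht hu => hg_bound k t u ht hu.1 hu.2
  rw [← hb₀] at p
  refine p.tendsto_zero (K := max |x₁| |x₂|) (div_pos hb₀_pos ha₀) ?_
    (h_bounds.mono fun t ht => abs_le_max_abs_abs ht.1 ht.2)
  convert h_main using 1
  · congr 1
    field_simp
  · field_simp

theorem theorem5 {m : ℕ} (hm : 1 ≤ m)
    (f : ℝ → ℝ → ℝ) (g : Fin m → ℝ → ℝ → ℝ) (h : Fin m → ℝ → ℝ)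
    -- the delays
    (hh : ∀ k, IsDelayFunction (h k))
    -- continuity and sign conditions on `[0, ∞) × ℝ`
    (hf_cont : ContinuousOn (Function.uncurry f) (Ici (0 : ℝ) ×ˢ univ))
    (hg_cont : ∀ k, ContinuousOn (Function.uncurry (g k)) (Ici (0 : ℝ) ×ˢ univ))
    (hf_zero : ∀ t, 0 ≤ t → f t 0 = 0)
    (hg_zero : ∀ k t, 0 ≤ t → g k t 0 = 0)
    (hf_sign : ∀ t u, 0 ≤ t → u ≠ 0 → 0 < f t u * u)
    (hg_sign : ∀ k t u, 0 ≤ t → u ≠ 0 → 0 < g k t u * u)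
    -- a priori bounds: every admissible initial function has a unique global solution,
    -- which eventually takes its values in `[x₁, x₂]`
    (x₁₀ x₂₀ : EReal) (x₁ x₂ : ℝ)
    (hx₁₀ : x₁₀ ≤ 0) (hx₂₀ : 0 ≤ x₂₀) (hx₁ : x₁ ≤ 0) (hx₂ : 0 ≤ x₂)
    (h_exists_unique : ∀ φ : Iic (0 : ℝ) → ℝ, IsAdmissibleInitial x₁₀ x₂₀ φ →
      ∃! x : ℝ → ℝ, IsDelaySolution f g h φ x)
    (h_bounds : ∀ φ : Iic (0 : ℝ) → ℝ, IsAdmissibleInitial x₁₀ x₂₀ φ →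
      ∀ x : ℝ → ℝ, IsDelaySolution f g h φ x → ∀ᶠ t in atTop, x₁ ≤ x t ∧ x t ≤ x₂)
    -- the quantitative conditions
    (a₀ A h₀ : ℝ) (b : Fin m → ℝ) (b₀ : ℝ)
    (ha₀ : 0 < a₀) (hA : 0 < A) (hb : ∀ k, 0 < b k) (hb₀ : b₀ = ∑ k, b k)
    (hf_bound : ∀ t u, 0 ≤ t → x₁ ≤ u → u ≤ x₂ → u ≠ 0 → a₀ ≤ f t u / u ∧ f t u / u ≤ A)
    (hg_bound : ∀ k t u, 0 ≤ t → x₁ ≤ u → u ≤ x₂ → u ≠ 0 →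
      0 ≤ g k t u / u ∧ g k t u / u ≤ b k)
    (h_delay : ∀ k t, 0 ≤ t → t - h k t ≤ h₀)
    (h_main : a₀ / b₀ * Real.exp (-(A * h₀)) >
      Real.log ((b₀ ^ 2 + a₀ * b₀) / (b₀ ^ 2 + a₀ ^ 2))) :
    ∀ φ : Iic (0 : ℝ) → ℝ, IsAdmissibleInitial x₁₀ x₂₀ φ →
      ∀ x : ℝ → ℝ, IsDelaySolution f g h φ x → Tendsto x atTop (𝓝 0) :=
  fun φ hφ x hx => theorem5_general hm f g h (fun k => (hh k).le_self) hf_cont hf_zero hg_zero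
    x₁ x₂ a₀ A h₀ b b₀ ha₀ hb hb₀ hf_bound hg_bound h_delay h_main φ x hx (h_bounds φ hφ x hx)
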